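/- A compact space means a compact Hausdorff space. A $k$-space is a topological space $X$ in which a subset $U$ is open if and only if $f^{-1}(U)$ is open for every continuous map $f:K\to X$ with $K$ compact; a space $X$ is weak Hausdorff if $f(K)$ is closed in $X$ for every such $f$. Let $\mathbf{Top}$ be the category of weak Hausdorff $k$-spaces and continuous maps. The Kelleyfication of a topology on $X$ is the final topology for all maps $K\to X$ with $K$ compact that are continuous for the given topology. A flow $X$ consists of a discrete space $X^0$, a weak Hausdorff $k$-space $\mathbb{P}X$, continuous maps $s,t:\mathbb{P}X\to X^0$ and a continuous associative map $*:\{(x,y)\in\mathbb{P}X\times\mathbb{P}X : t(x)=s(y)\}\to\mathbb{P}X$ (the domain being the fibre product formed in $\mathbf{Top}$, i.e. carrying the Kelleyfication of the subspace topology) such that $s(x*y)=s(x)$ and $t(x*y)=t(y)$. A morphism of flows $f:X\to Y$ consists of a set map $X^0\to Y^0$ and a continuous map $\mathbb{P}X\to\mathbb{P}Y$ that commute with $s$, $t$ and $*$; it is in particular a continuous map between the underlying spaces $X^0\sqcup\mathbb{P}X\to Y^0\sqcup\mathbb{P}Y$. Let $\mathbf{Flow}$ be the category of flows. For flows $X,Y$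 let $\mathbf{FLOW}(X,Y)$ be the set of morphisms of flows from $X$ to $Y$, equipped with the Kelleyfication of the compact-open topology (for maps between underlying spaces). **Theorem.** The mapping $(X,Y)\mapsto\mathbf{FLOW}(X,Y)$, together with composition of morphisms, is a functor from $\mathbf{Flow}\times\mathbf{Flow}$ to $\mathbf{Top}$, contravariant in $X$ and covariant in $Y$; in particular every $\mathbf{FLOW}(X,Y)$ is a weak Hausdorff $k$-space. Moreover: 1. For every flow $Y$ and every colimit $\varinjlim_i X_i$ in $\mathbf{Flow}$, the canonical map $\mathbf{FLOW}(\varinjlim_i X_i,Y)\to\varprojlim_i\mathbf{FLOW}(X_i,Y)$ is a homeomorphism, the limit being taken in $\mathbf{Top}$. 2. For every flow $X$ and every finite limit $\varprojlim_i Y_i$ in $\mathbf{Flow}$, the canonical map $\mathbf{FLOW}(X,\varprojlim_i Y_i)\to\varprojlim_i\mathbf{FLOW}(X,Y_i)$ is a homeomorphism, the limit being taken in $\mathbf{Top}$. -/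

import Mathlib

open CategoryTheory CategoryTheory.Limits Opposite

universe u v w

/-- A space is weak Hausdorff if every continuous image of a compact Hausdorff space in it is
closed. -/
class WeakHausdorffSpace (X : Type u) [TopologicalSpace X] : Prop where
  isClosed_range : ∀ (K : Type u) [TopologicalSpace K] [CompactSpace K] [T2Space K] (f : C(K, X)),
    IsClosed (Set.range f)

/-- The weak Hausdorff `k`-spaces. Here `CompactlyGeneratedSpace` is Mathlib's name for a `k`-space:
the topology is the final one for all continuous maps from compact Hausdorff spaces. -/
def isCGWH : ObjectProperty TopCat.{u} :=
  fun X => CompactlyGeneratedSpace X ∧ WeakHausdorffSpace X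

/-- The category of weak Hausdorff `k`-spaces and continuous maps. -/
abbrev CGWH : Type (u + 1) := (isCGWH.{u}).FullSubcategory

/-- The Kelleyfication of a topology: the final topology for all maps from compact Hausdorff spaces
that are continuous for the given topology. -/
abbrev kelleyfication {X : Type u} (t : TopologicalSpace X) : TopologicalSpace X :=
  @TopologicalSpace.compactlyGenerated.{u, u} X t

/-- Flows: a discrete space of states, a weak Hausdorff `k`-space of (non-constant) execution
paths, continuous source and target maps, and a continuous associative composition of composable
paths. The space of composable pairs is the fibre product formed in the category of weak Hausdorff
`k`-spaces, that is, the Kelleyfication of the subspace topology of the ordinary product. -/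
structure DirFlow : Type (u + 1) where
  State : Type u
  Path : Type u
  [topState : TopologicalSpace State]
  [discreteState : DiscreteTopology State]
  [topPath : TopologicalSpace Path]
  [cgPath : CompactlyGeneratedSpace Path]
  [whPath : WeakHausdorffSpace Path]
  src : C(Path, State)
  tgt : C(Path, State)
  comp : ∀ x y : Path, tgt x = src y → Path
  continuous_comp :
    @Continuous {p : Path × Path // tgt p.1 = src p.2} Path (kelleyfication inferInstance) topPath
      (fun p => comp p.1.1 p.1.2 p.2)
  src_comp : ∀ x y (h : tgt x = src y), src (comp x y h) = src x
  tgt_comp : ∀ x y (h : tgt x = src y), tgt (comp x y h) = tgt y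
  assoc : ∀ x y z (hxy : tgt x = src y) (hyz : tgt y = src z),
    comp (comp x y hxy) z ((tgt_comp x y hxy).trans hyz) =
      comp x (comp y z hyz) (hxy.trans (src_comp y z hyz).symm)

namespace DirFlow

attribute [instance] topState discreteState topPath cgPath whPath

/-- Morphisms of flows: a map on states and a continuous map on paths, compatible with source,
target and composition. -/
@[ext]
structure Hom (X Y : DirFlow.{u}) : Type u where
  onState : X.State → Y.State
  onPath : C(X.Path, Y.Path)
  map_src : ∀ x, onState (X.src x) = Y.src (onPath x)
  map_tgt : ∀ x, onState (X.tgt x) = Y.tgt (onPath x)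
  map_comp : ∀ x y (h : X.tgt x = X.src y),
    onPath (X.comp x y h) =
      Y.comp (onPath x) (onPath y) (by rw [← map_tgt, h, map_src])

/-- The category of flows. -/
instance : Category.{u} DirFlow.{u} where
  Hom := Hom
  id X :=
    { onState := id
      onPath := ContinuousMap.id X.Path
      map_src := fun _ => rfl
      map_tgt := fun _ => rfl
      map_comp := fun _ _ _ => rfl }
  comp {X Y Z} f g :=
    { onState := g.onState ∘ f.onState
      onPath := g.onPath.comp f.onPath
      map_src := fun x => by simp [f.map_src, g.map_src]
      map_tgt := fun x => by simp [f.map_tgt, g.map_tgt]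
      map_comp := fun x y h => by simp [f.map_comp, g.map_comp] }

/-- The underlying space of a flow: the disjoint sum of its states and of its paths. -/
abbrev Total (X : DirFlow.{u}) : Type u := X.State ⊕ X.Path

/-- The continuous map between underlying spaces given by a morphism of flows. -/
def Hom.total {X Y : DirFlow.{u}} (f : Hom X Y) : C(X.Total, Y.Total) where
  toFun := Sum.map f.onState f.onPath
  continuous_toFun := continuous_of_discreteTopology.sumMap f.onPath.continuous

/-- The space of morphisms of flows from `X` to `Y`. -/
def FLOW (X Y : DirFlow.{u}) : Type u := X ⟶ Y

/-- The compact-open topology on the set of morphisms of flows, these being regarded as continuous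
maps between underlying spaces. -/
abbrev compactOpen (X Y : DirFlow.{u}) : TopologicalSpace (FLOW X Y) :=
  TopologicalSpace.induced (Hom.total : FLOW X Y → C(X.Total, Y.Total)) ContinuousMap.compactOpen

/-- `FLOW X Y` carries the Kelleyfication of the compact-open topology. -/
instance (X Y : DirFlow.{u}) : TopologicalSpace (FLOW X Y) := kelleyfication (compactOpen X Y)

/-- The map `φ ↦ g ∘ φ ∘ f` from `FLOW X Y` to `FLOW X' Y'`. -/
def FLOW.map {X X' Y Y' : DirFlow.{u}} (f : X' ⟶ X) (g : Y ⟶ Y') : FLOW X Y → FLOW X' Y' :=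
  fun φ => f ≫ (φ : X ⟶ Y) ≫ g

/-- All spaces `FLOW X Y` are weak Hausdorff `k`-spaces. -/
def FLOWIsCGWH : Prop := ∀ X Y : DirFlow.{u}, isCGWH (TopCat.of (FLOW X Y))

/-- All maps `φ ↦ g ∘ φ ∘ f` are continuous. -/
def FLOWMapContinuous : Prop :=
  ∀ ⦃X X' Y Y' : DirFlow.{u}⦄ (f : X' ⟶ X) (g : Y ⟶ Y'), Continuous (FLOW.map f g)

/-- The functor `(X, Y) ↦ FLOW X Y`, contravariant in `X` and covariant in `Y`, with values in weak
Hausdorff `k`-spaces, once its values on objects and on morphisms are known to be objects and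
morphisms of that category. -/
def flowFunctor (hobj : FLOWIsCGWH.{u}) (hmap : FLOWMapContinuous.{u}) :
    DirFlow.{u}ᵒᵖ × DirFlow.{u} ⥤ CGWH.{u} where
  obj P := ⟨TopCat.of (FLOW P.1.unop P.2), hobj P.1.unop P.2⟩
  map a := ObjectProperty.homMk (TopCat.ofHom ⟨FLOW.map a.1.unop a.2, hmap a.1.unop a.2⟩)
  map_id _ := rfl
  map_comp _ _ := rfl

end DirFlow

/-!
The underlying set of `FLOW X Y` is a hom-set, and hom functors turn colimits in the first variable
and limits in the second one into limits of sets. What remains is topological: a family of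
morphisms `Z → FLOW X Y`, which may be tested on compact Hausdorff `Z = K`, has to be continuous as
soon as its restrictions to the `X i`, or its projections to the `Y i`, are.

A continuous family `K → FLOW X Y` amounts to a single morphism `X ⟶ Y ^ K` to the flow of
continuous families of states and of paths of `Y`. If `X` is a colimit, the families on the `X i`
therefore glue to a morphism `X ⟶ Y ^ K`, that is, to a continuous family.

If `Y` is a limit, maps `M → ℙ Y` are tested by the flow with space of paths `M` in which sources
and targets are disjoint, so that nothing is composable and morphisms out of it are just continuous
families of paths. Its sources and targets have to vary continuously in the discrete set `Y⁰`, and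
this follows from the continuity of their projections to the `Y i` when there are finitely many
of these: a point of `Y⁰` is then a finite intersection of preimages of points.
-/

section Topology

instance (priority := 100) {X : Type u} [TopologicalSpace X] [T2Space X] :
    WeakHausdorffSpace X where
  isClosed_range _ _ _ _ f := (isCompact_range f.continuous).isClosed

theorem t2Space_of_isClosedMap_of_surjective {X Y : Type*} [TopologicalSpace X]
    [TopologicalSpace Y] [NormalSpace X] [T1Space Y] {f : X → Y} (hf : Continuous f)
    (hcl : IsClosedMap f) (hsurj : Function.Surjective f) : T2Space Y where
  t2 y y' hne := by
    obtain ⟨U, V, hU, hV, hyU, hyV, hUV⟩ := normal_separation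
      (isClosed_singleton.preimage hf) (isClosed_singleton.preimage hf)
      ((Set.disjoint_singleton.2 hne).preimage f)
    refine ⟨Set.kernImage f U, Set.kernImage f V, isClosedMap_iff_kernImage.1 hcl hU,
      isClosedMap_iff_kernImage.1 hcl hV, fun _ h => hyU h, fun _ h => hyV h, ?_⟩
    refine Set.disjoint_left.2 fun z hzU hzV => ?_
    obtain ⟨x, rfl⟩ := hsurj z
    exact Set.disjoint_left.1 hUV (hzU rfl) (hzV rfl)

namespace WeakHausdorffSpace

variable {K L X Y : Type u} [TopologicalSpace K] [CompactSpace K] [T2Space K]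
  [TopologicalSpace L] [CompactSpace L] [T2Space L] [TopologicalSpace X] [TopologicalSpace Y]

instance (priority := 100) [WeakHausdorffSpace Y] : T1Space Y where
  t1 y := by simpa using isClosed_range PUnit.{u + 1} ⟨fun _ => y, continuous_const⟩

theorem isClosedMap [WeakHausdorffSpace Y] {f : K → Y} (hf : Continuous f) : IsClosedMap f := by
  intro s hs
  have : CompactSpace s := isCompact_iff_compactSpace.1 hs.isCompact
  simpa [Set.range_comp] using isClosed_range s ⟨f ∘ ((↑) : s → K), hf.comp continuous_subtype_val⟩

theorem t2Space_range [WeakHausdorffSpace Y] {f : K → Y} (hf : Continuous f) :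
    T2Space (Set.range f) :=
  t2Space_of_isClosedMap_of_surjective hf.rangeFactorization
    ((isClosedMap hf).codRestrict Set.mem_range_self) Set.rangeFactorization_surjective

theorem isClosed_eqLocus [WeakHausdorffSpace Y] {f : K → Y} {g : L → Y}
    (hf : Continuous f) (hg : Continuous g) : IsClosed {p : K × L | f p.1 = g p.2} := by
  have hfg : Continuous (Sum.elim f g) := hf.sumElim hg
  have := t2Space_range hfg
  simpa [Subtype.ext_iff] using isClosed_eq
    (hfg.rangeFactorization.comp (continuous_inl.comp continuous_fst))
    (hfg.rangeFactorization.comp (continuous_inr.comp continuous_snd) :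
      Continuous fun p : K × L => Set.rangeFactorization (Sum.elim f g) (Sum.inr p.2))

theorem of_isClosed_eqLocus [CompactlyGeneratedSpace X]
    (h : ∀ (K L : Type u) [TopologicalSpace K] [CompactSpace K] [T2Space K] [TopologicalSpace L]
      [CompactSpace L] [T2Space L] (f : K → X) (g : L → X), Continuous f → Continuous g →
        IsClosed {p : K × L | f p.1 = g p.2}) : WeakHausdorffSpace X where
  isClosed_range K _ _ _ f := by
    refine CompactlyGeneratedSpace.isClosed' fun L _ _ _ g hg => ?_
    have hrange : g ⁻¹' Set.range f = Prod.snd '' {p : K × L | f p.1 = g p.2} := by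
      ext l
      simp
    rw [hrange]
    exact isClosedMap_snd_of_compactSpace _ (h K L f g f.continuous hg)

end WeakHausdorffSpace

theorem continuous_prod_of_compactlyGeneratedSpace {K Y : Type*} {X : Type u} [TopologicalSpace K]
    [LocallyCompactSpace K] [TopologicalSpace X] [CompactlyGeneratedSpace X] [TopologicalSpace Y]
    {f : K × X → Y} (h : ∀ (L : Type u) [TopologicalSpace L] [CompactSpace L] [T2Space L]
      (g : L → X), Continuous g → Continuous fun p : K × L => f (p.1, g p.2)) :
    Continuous f := by
  have hx (x : X) : Continuous fun k => f (k, x) :=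
    (h PUnit.{u + 1} (fun _ => x) continuous_const).comp
      (continuous_id.prodMk (continuous_const (y := PUnit.unit)))
  let curried : X → C(K, Y) := fun x => ⟨fun k => f (k, x), hx x⟩
  have hcurried : Continuous curried :=
    continuous_from_compactlyGeneratedSpace curried fun L _ _ _ g hg =>
      ContinuousMap.continuous_of_continuous_uncurry _ ((h L g hg).comp continuous_swap)
  exact (ContinuousMap.continuous_uncurry_of_continuous ⟨curried, hcurried⟩).comp continuous_swap

theorem discreteTopology_continuousMap {K S : Type*} [TopologicalSpace K] [CompactSpace K]
    [TopologicalSpace S] [DiscreteTopology S] : DiscreteTopology C(K, S) := by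
  refine discreteTopology_iff_isOpen_singleton.2 fun g => ?_
  have hg : {g} = ⋂ s ∈ Set.range g, {h : C(K, S) | Set.MapsTo h (g ⁻¹' {s}) {s}} := by
    ext h
    simp only [Set.mem_singleton_iff, ContinuousMap.ext_iff, Set.mem_iInter, Set.forall_mem_range,
      Set.mem_ofPred_eq, Set.MapsTo, Set.mem_preimage]
    exact ⟨fun hgh k l hl => (hgh l).trans hl, fun hgh k => hgh k rfl⟩
  rw [hg]
  exact (isCompact_range g.continuous).finite_of_discrete.isOpen_biInter fun s _ =>
    ContinuousMap.isOpen_setOfPred_mapsTo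
      ((isClosed_discrete {s}).preimage g.continuous).isCompact (isOpen_discrete {s})

end Topology

section Kelleyfication

variable {X Z : Type u}

theorem kelleyfication_le (t : TopologicalSpace X) : kelleyfication t ≤ t :=
  continuous_id_iff_le.1 (continuous_from_compactlyGenerated id fun _ g => g.continuous)

theorem continuous_kelleyfication_iff [TopologicalSpace Z] [CompactlyGeneratedSpace Z]
    {t : TopologicalSpace X} {f : Z → X} :
    @Continuous _ _ _ (kelleyfication t) f ↔ Continuous f := by
  refine ⟨continuous_le_rng (kelleyfication_le t), fun hf => ?_⟩
  refine @continuous_from_compactlyGeneratedSpace _ _ _ (kelleyfication t) _ f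
    fun K _ _ _ g hg => ?_
  exact @Continuous.comp _ _ _ _ _ (kelleyfication t) _
    (fun x : Σ i : (S : CompHaus.{u}) × C(S, X), i.fst => x.1.2 x.2) continuous_coinduced_rng
    (continuous_sigmaMk (σ := fun i : (S : CompHaus.{u}) × C(S, X) => i.fst)
      (i := ⟨CompHaus.of K, ⟨f ∘ g, hf.comp hg⟩⟩))

theorem compactlyGeneratedSpace_kelleyfication (t : TopologicalSpace X) :
    @CompactlyGeneratedSpace X (kelleyfication t) :=
  @uCompactlyGeneratedSpace_of_coinduced _ _ _ (kelleyfication t) _ _ continuous_coinduced_rng rfl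

end Kelleyfication

section MappingSpace

variable (K X : Type u) [TopologicalSpace K] [TopologicalSpace X]

/-- The mapping space of weak Hausdorff `k`-spaces: the continuous maps from `K` to `X`, with the
Kelleyfication of the compact-open topology. It is a separate type because `C(K, X)` already
carries the compact-open topology. -/
def KMap : Type u := C(K, X)

namespace KMap

instance : FunLike (KMap K X) K X := inferInstanceAs (FunLike C(K, X) K X)

instance : ContinuousMapClass (KMap K X) K X := inferInstanceAs (ContinuousMapClass C(K, X) K X)

instance : TopologicalSpace (KMap K X) :=
  kelleyfication (inferInstanceAs (TopologicalSpace C(K, X)))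

instance : CompactlyGeneratedSpace (KMap K X) :=
  compactlyGeneratedSpace_kelleyfication _

variable {K X}

theorem continuous_toContinuousMap : Continuous (Y := C(K, X)) fun p : KMap K X => p :=
  continuous_id_iff_le.2 (kelleyfication_le ContinuousMap.compactOpen)

instance : ContinuousEvalConst (KMap K X) K X where
  continuous_eval_const k :=
    (continuous_eval_const (F := C(K, X)) k).comp continuous_toContinuousMap

theorem continuous_iff [LocallyCompactSpace K] {Z : Type u} [TopologicalSpace Z]
    [CompactlyGeneratedSpace Z] {φ : Z → KMap K X} :
    Continuous φ ↔ Continuous fun p : Z × K => φ p.1 p.2 :=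
  (continuous_kelleyfication_iff (X := C(K, X))).trans
    ⟨fun h => ContinuousMap.continuous_uncurry_of_continuous ⟨_, h⟩,
      fun h => ContinuousMap.continuous_of_continuous_uncurry _ h⟩

instance [WeakHausdorffSpace X] : WeakHausdorffSpace (KMap K X) :=
  .of_isClosed_eqLocus fun _ _ _ _ _ _ _ _ f g hf hg => by
    simp only [DFunLike.ext_iff, Set.ofPred_forall]
    exact isClosed_iInter fun k => WeakHausdorffSpace.isClosed_eqLocus
      ((continuous_eval_const k).comp hf) ((continuous_eval_const k).comp hg)

end KMap

end MappingSpace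

namespace CGWH

theorem nonempty_isLimit_of_forget {J : Type w} [Category.{v} J] {F : J ⥤ CGWH.{u}} {c : Cone F}
    (hc : IsLimit ((forget CGWH.{u}).mapCone c))
    (hcont : ∀ (Z : Type u) [TopologicalSpace Z] [CompactlyGeneratedSpace Z] (f : Z → c.pt.obj),
      (∀ j, Continuous fun z => (c.π.app j).hom (f z)) → Continuous f) :
    Nonempty (IsLimit c) := by
  have hlift (s : Cone F) :
      Continuous (X := s.pt.obj) (Y := c.pt.obj) (hc.lift ((forget CGWH).mapCone s)) := by
    have : CompactlyGeneratedSpace s.pt.obj := s.pt.property.1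
    refine hcont _ _ fun j => ?_
    have hfac (z : s.pt.obj) : (c.π.app j).hom (hc.lift ((forget CGWH).mapCone s) z) =
        (s.π.app j).hom.hom z :=
      ConcreteCategory.congr_hom (hc.fac ((forget CGWH).mapCone s) j) z
    simpa only [hfac] using (s.π.app j).hom.hom.continuous
  exact ⟨.ofFaithful (forget CGWH) hc
    (fun s => ObjectProperty.homMk (TopCat.ofHom ⟨_, hlift s⟩)) fun _ => rfl⟩

end CGWH

namespace DirFlow

variable {X Y : DirFlow.{u}}

namespace FLOW

instance (X Y : DirFlow.{u}) : CompactlyGeneratedSpace (FLOW X Y) :=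
  compactlyGeneratedSpace_kelleyfication _

theorem continuous_iff {K : Type u} [TopologicalSpace K] [LocallyCompactSpace K]
    [CompactlyGeneratedSpace K] {φ : K → FLOW X Y} :
    Continuous φ ↔ (∀ x, Continuous fun k => Hom.onState (φ k) x) ∧
      Continuous fun p : K × X.Path => Hom.onPath (φ p.1) p.2 := by
  refine continuous_kelleyfication_iff.trans (continuous_induced_rng.trans ⟨fun h => ⟨?_, ?_⟩, ?_⟩)
  · exact fun x => Topology.IsEmbedding.inl.continuous_iff.2
      ((continuous_eval_const (F := C(X.Total, Y.Total)) (Sum.inl x)).comp h)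
  · refine continuous_prod_of_compactlyGeneratedSpace fun L _ _ _ g hg => ?_
    let i : C(L, X.Total) := ⟨fun l => Sum.inr (g l), continuous_inr.comp hg⟩
    exact Topology.IsEmbedding.inr.continuous_iff.2
      (ContinuousMap.continuous_uncurry_of_continuous
        ⟨_, (ContinuousMap.continuous_precomp (Z := Y.Total) i).comp h⟩)
  · rintro ⟨hstate, hpath⟩
    refine ContinuousMap.continuous_of_continuous_uncurry _ ?_
    rw [← Homeomorph.prodSumDistrib.symm.comp_continuous_iff', continuous_sum_dom]
    exact ⟨continuous_inl.comp (continuous_prod_of_discrete_right.2 hstate),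
      continuous_inr.comp hpath⟩

theorem ext_iff {φ ψ : FLOW X Y} : φ = ψ ↔
    (∀ x, Hom.onState φ x = Hom.onState ψ x) ∧ ∀ x, Hom.onPath φ x = Hom.onPath ψ x := by
  rw [← funext_iff, ← ContinuousMap.ext_iff]
  exact Hom.ext_iff

instance (X Y : DirFlow.{u}) : WeakHausdorffSpace (FLOW X Y) :=
  .of_isClosed_eqLocus fun _ _ _ _ _ _ _ _ f g hf hg => by
    have hpath {M : Type u} [TopologicalSpace M] [CompactSpace M] [T2Space M] {f : M → FLOW X Y}
        (hf : Continuous f) (x : X.Path) : Continuous fun m => Hom.onPath (f m) x :=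
      (continuous_iff.1 hf).2.comp (continuous_id.prodMk continuous_const)
    simp only [FLOW.ext_iff, Set.ofPred_and, Set.ofPred_forall]
    refine (isClosed_iInter fun x => ?_).inter (isClosed_iInter fun x => ?_)
    · exact WeakHausdorffSpace.isClosed_eqLocus
        ((continuous_iff.1 hf).1 x) ((continuous_iff.1 hg).1 x)
    · exact WeakHausdorffSpace.isClosed_eqLocus (hpath hf x) (hpath hg x)

end FLOW

theorem flowIsCGWH : FLOWIsCGWH.{u} := fun X Y =>
  ⟨inferInstanceAs (CompactlyGeneratedSpace (FLOW X Y)),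
    inferInstanceAs (WeakHausdorffSpace (FLOW X Y))⟩

theorem flowMapContinuous : FLOWMapContinuous.{u} := fun _ _ _ _ f g =>
  continuous_from_compactlyGeneratedSpace _ fun _ _ _ _ φ hφ => by
    obtain ⟨hstate, hpath⟩ := FLOW.continuous_iff.1 hφ
    refine FLOW.continuous_iff.2 ⟨fun x => ?_, ?_⟩
    · exact (continuous_of_discreteTopology (f := Hom.onState g)).comp (hstate (Hom.onState f x))
    · exact (Hom.onPath g).continuous.comp
        (hpath.comp (continuous_id.prodMap (Hom.onPath f).continuous))

theorem continuous_comp_of_continuous {L : Type u} [TopologicalSpace L] [CompactlyGeneratedSpace L]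
    {f g : L → Y.Path} (hf : Continuous f) (hg : Continuous g)
    (h : ∀ l, Y.tgt (f l) = Y.src (g l)) : Continuous fun l => Y.comp (f l) (g l) (h l) :=
  have hfg : Continuous fun l =>
      (⟨(f l, g l), h l⟩ : {p : Y.Path × Y.Path // Y.tgt p.1 = Y.src p.2}) :=
    (hf.prodMk hg).subtype_mk h
  @Continuous.comp _ _ _ _ (kelleyfication inferInstance) _ _ _ Y.continuous_comp
    (continuous_kelleyfication_iff.2 hfg)

section Cotensor

variable (K : Type u) [TopologicalSpace K] [CompactSpace K] [T2Space K]

/-- The cotensor `Y ^ K` of a flow by a compact Hausdorff space: its states and its paths are the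
continuous families of states and of paths of `Y` parametrised by `K`. -/
def cotensor (Y : DirFlow.{u}) : DirFlow.{u} where
  State := C(K, Y.State)
  Path := KMap K Y.Path
  discreteState := discreteTopology_continuousMap
  src := ⟨fun p => Y.src.comp p,
    (ContinuousMap.continuous_postcomp Y.src).comp KMap.continuous_toContinuousMap⟩
  tgt := ⟨fun p => Y.tgt.comp p,
    (ContinuousMap.continuous_postcomp Y.tgt).comp KMap.continuous_toContinuousMap⟩
  comp p q h := ⟨fun k => Y.comp (p k) (q k) (DFunLike.congr_fun h k),
    continuous_comp_of_continuous (map_continuous p) (map_continuous q) _⟩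
  continuous_comp := continuous_from_compactlyGenerated _ fun L g => by
    have hg := continuous_subtype_val.comp g.continuous
    exact KMap.continuous_iff.2 (continuous_comp_of_continuous
      (KMap.continuous_iff.1 (continuous_fst.comp hg))
      (KMap.continuous_iff.1 (continuous_snd.comp hg))
      fun p : L × K => DFunLike.congr_fun (g p.1).2 p.2)
  src_comp _ _ _ := ContinuousMap.ext fun _ => Y.src_comp _ _ _
  tgt_comp _ _ _ := ContinuousMap.ext fun _ => Y.tgt_comp _ _ _
  assoc _ _ _ _ _ := ContinuousMap.ext fun _ => Y.assoc _ _ _ _ _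

variable {K}

/-- Evaluation of families at the parameter `k`. -/
def cotensorEval (Y : DirFlow.{u}) (k : K) : cotensor K Y ⟶ Y where
  onState s := s.toFun k
  onPath := ⟨fun p : KMap K Y.Path => p k, continuous_eval_const (F := KMap K Y.Path) k⟩
  map_src _ := rfl
  map_tgt _ := rfl
  map_comp _ _ _ := rfl

/-- The universal property of the cotensor: a morphism to `Y ^ K` is a continuous family of
morphisms to `Y`. -/
def homCotensorEquiv : C(K, FLOW X Y) ≃ (X ⟶ cotensor K Y) where
  toFun φ :=
    { onState x := ⟨fun k => Hom.onState (φ k) x, (FLOW.continuous_iff.1 φ.continuous).1 x⟩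
      onPath := ⟨fun x => (⟨fun k => Hom.onPath (φ k) x,
          (FLOW.continuous_iff.1 φ.continuous).2.comp (.prodMk_left x)⟩ : C(K, Y.Path)),
        KMap.continuous_iff.2 ((FLOW.continuous_iff.1 φ.continuous).2.comp continuous_swap)⟩
      map_src x := ContinuousMap.ext fun k => Hom.map_src (φ k) x
      map_tgt x := ContinuousMap.ext fun k => Hom.map_tgt (φ k) x
      map_comp x y h := ContinuousMap.ext fun k => Hom.map_comp (φ k) x y h }
  invFun f :=
    { toFun k := f ≫ cotensorEval Y k
      continuous_toFun := FLOW.continuous_iff.2 ⟨fun x => (Hom.onState f x).continuous,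
        (KMap.continuous_iff.1 (Hom.onPath f).continuous).comp continuous_swap⟩ }
  left_inv _ := rfl
  right_inv _ := rfl

theorem comp_homCotensorEquiv {X' : DirFlow.{u}} (f : X' ⟶ X) (φ : C(K, FLOW X Y)) :
    f ≫ homCotensorEquiv φ = homCotensorEquiv
      ⟨fun k => FLOW.map f (𝟙 Y) (φ k), (flowMapContinuous f (𝟙 Y)).comp φ.continuous⟩ :=
  rfl

end Cotensor

section Colimits

variable {J : Type w} [Category.{v} J] {D : J ⥤ DirFlow.{u}} {c : Cocone D}

theorem continuous_of_isColimit (hc : IsColimit c) {Z : Type u} [TopologicalSpace Z]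
    [CompactlyGeneratedSpace Z] (φ : Z → FLOW c.pt Y)
    (h : ∀ j, Continuous fun z => FLOW.map (c.ι.app j) (𝟙 Y) (φ z)) :
    Continuous φ := by
  refine continuous_from_compactlyGeneratedSpace _ fun K _ _ _ g hg => ?_
  let leg (j : J) : C(K, FLOW (D.obj j) Y) := ⟨_, (h j).comp hg⟩
  let s : Cocone D :=
    { pt := cotensor K Y
      ι :=
        { app j := homCotensorEquiv (leg j)
          naturality i j f := by
            have hleg (k : K) : FLOW.map (D.map f) (𝟙 Y) (leg j k) = leg i k :=
              congrArg (fun a => FLOW.map a (𝟙 Y) (φ (g k))) (c.w f)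
            exact (comp_homCotensorEquiv (D.map f) (leg j)).trans
              (congrArg homCotensorEquiv (ContinuousMap.ext hleg)) } }
  have hφ : φ ∘ g = homCotensorEquiv.symm (hc.desc s) := funext fun k => hc.hom_ext fun j =>
    (congrArg (fun f => homCotensorEquiv.symm f k) (hc.fac s j)).symm
  rw [hφ]
  exact ContinuousMap.continuous _

end Colimits

section Glob

variable {M S T : Type u} [TopologicalSpace M] [CompactlyGeneratedSpace M] [WeakHausdorffSpace M]
  [TopologicalSpace S] [DiscreteTopology S] [TopologicalSpace T] [DiscreteTopology T]
  {s : C(M, S)} {t : C(M, T)}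

/-- The flow whose space of paths is `M`, with sources in `S` and targets in `T`. The sets of
possible sources and targets are kept disjoint so that no two paths are composable. -/
def glob (s : C(M, S)) (t : C(M, T)) : DirFlow.{u} where
  State := S ⊕ T
  Path := M
  src := ⟨fun m => Sum.inl (s m), continuous_inl.comp s.continuous⟩
  tgt := ⟨fun m => Sum.inr (t m), continuous_inr.comp t.continuous⟩
  comp _ _ h := (Sum.inr_ne_inl h).elim
  continuous_comp := continuous_from_compactlyGenerated _ fun L g =>
    have : IsEmpty L := ⟨fun l => Sum.inr_ne_inl (g l).2⟩
    continuous_of_discreteTopology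
  src_comp _ _ h := (Sum.inr_ne_inl h).elim
  tgt_comp _ _ h := (Sum.inr_ne_inl h).elim
  assoc _ _ _ h := (Sum.inr_ne_inl h).elim

/-- The universal property of `glob`: a morphism out of it is a continuous family of paths whose
sources and targets factor through `S` and `T`. -/
def globDesc (f : S → Y.State) (g : T → Y.State) (p : C(M, Y.Path))
    (hf : ∀ m, f (s m) = Y.src (p m)) (hg : ∀ m, g (t m) = Y.tgt (p m)) : glob s t ⟶ Y where
  onState := Sum.elim f g
  onPath := p
  map_src := hf
  map_tgt := hg
  map_comp _ _ h := (Sum.inr_ne_inl h).elim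

theorem glob_hom_ext {a b : glob s t ⟶ Y}
    (hsrc : ∀ x, Hom.onState a (Sum.inl x) = Hom.onState b (Sum.inl x))
    (htgt : ∀ x, Hom.onState a (Sum.inr x) = Hom.onState b (Sum.inr x))
    (hpath : ∀ m : M, Hom.onPath a m = Hom.onPath b m) : a = b :=
  Hom.ext (funext (Sum.rec hsrc htgt)) (ContinuousMap.ext hpath)

end Glob

section Limits

variable {J : Type w} [Category.{v} J] {D : J ⥤ DirFlow.{u}} {c : Cone D} (hc : IsLimit c)
include hc

theorem onState_injective_of_isLimit {x y : c.pt.State}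
    (h : ∀ j, Hom.onState (c.π.app j) x = Hom.onState (c.π.app j) y) : x = y := by
  let pick (z : c.pt.State) : glob (M := PEmpty.{u + 1}) (.const _ PUnit.unit.{u + 1})
      (.const _ PUnit.unit.{u + 1}) ⟶ c.pt :=
    globDesc (fun _ => z) (fun _ => z) ⟨PEmpty.elim, continuous_of_discreteTopology⟩ nofun nofun
  have hxy : pick x = pick y :=
    hc.hom_ext fun j => glob_hom_ext (fun _ => h j) (fun _ => h j) nofun
  exact congrFun (congrArg Hom.onState hxy) (Sum.inl PUnit.unit)

theorem onPath_injective_of_isLimit {x y : c.pt.Path}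
    (h : ∀ j, Hom.onPath (c.π.app j) x = Hom.onPath (c.π.app j) y) : x = y := by
  let pick (z : c.pt.Path) : glob (.id PUnit.{u + 1}) (.id PUnit.{u + 1}) ⟶ c.pt :=
    globDesc (fun _ => c.pt.src z) (fun _ => c.pt.tgt z) (.const _ z) (fun _ => rfl) (fun _ => rfl)
  have hsrc (j : J) : Hom.onState (c.π.app j) (c.pt.src x) =
      Hom.onState (c.π.app j) (c.pt.src y) :=
    (Hom.map_src (c.π.app j) x).trans
      ((congrArg (D.obj j).src (h j)).trans (Hom.map_src (c.π.app j) y).symm)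
  have htgt (j : J) : Hom.onState (c.π.app j) (c.pt.tgt x) =
      Hom.onState (c.π.app j) (c.pt.tgt y) :=
    (Hom.map_tgt (c.π.app j) x).trans
      ((congrArg (D.obj j).tgt (h j)).trans (Hom.map_tgt (c.π.app j) y).symm)
  have hxy : pick x = pick y := hc.hom_ext fun j =>
    glob_hom_ext (fun _ => hsrc j) (fun _ => htgt j) fun _ => h j
  exact DFunLike.congr_fun (congrArg Hom.onPath hxy) PUnit.unit

theorem continuous_state_of_isLimit [Finite J] {Z : Type*} [TopologicalSpace Z]
    {f : Z → c.pt.State} (h : ∀ j, Continuous fun z => Hom.onState (c.π.app j) (f z)) :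
    Continuous f := by
  refine continuous_discrete_rng.2 fun x => ?_
  have hx : f ⁻¹' {x} = ⋂ j, (fun z => Hom.onState (c.π.app j) (f z)) ⁻¹'
      {Hom.onState (c.π.app j) x} := by
    ext z
    simp only [Set.mem_preimage, Set.mem_singleton_iff, Set.mem_iInter]
    exact ⟨fun e j => by rw [e], onState_injective_of_isLimit hc⟩
  rw [hx]
  exact isOpen_iInter_of_finite fun j => (isOpen_discrete _).preimage (h j)

theorem continuous_path_of_isLimit {M : Type u} [TopologicalSpace M] [CompactlyGeneratedSpace M]
    [WeakHausdorffSpace M] {f : M → c.pt.Path} (hsrc : Continuous fun m => c.pt.src (f m))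
    (htgt : Continuous fun m => c.pt.tgt (f m))
    (h : ∀ j, Continuous fun m => Hom.onPath (c.π.app j) (f m)) : Continuous f := by
  let s : Cone D :=
    { pt := glob ⟨_, hsrc⟩ ⟨_, htgt⟩
      π :=
        { app j := globDesc (Hom.onState (c.π.app j)) (Hom.onState (c.π.app j)) ⟨_, h j⟩
            (fun _ => Hom.map_src _ _) (fun _ => Hom.map_tgt _ _)
          naturality i j a := by
            have hstate (x) := (congrFun (congrArg Hom.onState (c.w a)) x).symm
            exact glob_hom_ext hstate hstate fun m =>
              (DFunLike.congr_fun (congrArg Hom.onPath (c.w a)) (f m)).symm } }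
  have hf : f = fun m : M => Hom.onPath (hc.lift s) m := funext fun m =>
    onPath_injective_of_isLimit hc fun j =>
      (DFunLike.congr_fun (congrArg Hom.onPath (hc.fac s j)) m).symm
  rw [hf]
  exact (Hom.onPath (hc.lift s)).continuous

theorem continuous_path_of_isLimit_of_finite [Finite J] {M : Type u} [TopologicalSpace M]
    [CompactlyGeneratedSpace M] [WeakHausdorffSpace M] {f : M → c.pt.Path}
    (h : ∀ j, Continuous fun m => Hom.onPath (c.π.app j) (f m)) : Continuous f := by
  refine continuous_path_of_isLimit hc (continuous_state_of_isLimit hc fun j => ?_)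
    (continuous_state_of_isLimit hc fun j => ?_) h
  · exact ((D.obj j).src.continuous.comp (h j)).congr fun m => (Hom.map_src (c.π.app j) (f m)).symm
  · exact ((D.obj j).tgt.continuous.comp (h j)).congr fun m => (Hom.map_tgt (c.π.app j) (f m)).symm

theorem continuous_of_isLimit [Finite J] {Z : Type u} [TopologicalSpace Z]
    [CompactlyGeneratedSpace Z] (φ : Z → FLOW X c.pt)
    (h : ∀ j, Continuous fun z => FLOW.map (𝟙 X) (c.π.app j) (φ z)) : Continuous φ := by
  refine continuous_from_compactlyGeneratedSpace _ fun K _ _ _ g hg => ?_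
  have hφ (j : J) := FLOW.continuous_iff.1 ((h j).comp hg)
  refine FLOW.continuous_iff.2 ⟨fun x => continuous_state_of_isLimit hc fun j => (hφ j).1 x, ?_⟩
  refine continuous_prod_of_compactlyGeneratedSpace fun L _ _ _ l hl => ?_
  exact continuous_path_of_isLimit_of_finite hc fun j => (hφ j).2.comp (continuous_id.prodMap hl)

end Limits

section Functor

variable (hobj : FLOWIsCGWH.{u}) (hmap : FLOWMapContinuous.{u})

/-- Forgetting topologies, `FLOW(-, Y)` is the contravariant hom functor of `Y`. -/
def sectLFlowFunctorForgetIso (Y : DirFlow.{u}) :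
    (Prod.sectL DirFlow.{u}ᵒᵖ Y ⋙ flowFunctor hobj hmap) ⋙ forget CGWH ≅ yoneda.obj Y :=
  NatIso.ofComponents fun _ => Iso.refl _

/-- Forgetting topologies, `FLOW(X, -)` is the covariant hom functor of `X`. -/
def sectRFlowFunctorForgetIso (X : DirFlow.{u}) :
    (Prod.sectR (op X) DirFlow.{u} ⋙ flowFunctor hobj hmap) ⋙ forget CGWH ≅ coyoneda.obj (op X) :=
  NatIso.ofComponents fun _ => Iso.refl _

variable {J : Type w} [Category.{v} J] {D : J ⥤ DirFlow.{u}}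

theorem nonempty_isLimit_flowFunctor_of_isColimit {c : Cocone D} (hc : IsColimit c)
    (Y : DirFlow.{u}) :
    Nonempty (IsLimit ((Prod.sectL DirFlow.{u}ᵒᵖ Y ⋙ flowFunctor hobj hmap).mapCone c.op)) :=
  CGWH.nonempty_isLimit_of_forget
    (IsLimit.mapConeEquiv (sectLFlowFunctorForgetIso hobj hmap Y).symm
      (isLimitOfPreserves (yoneda.obj Y) hc.op))
    fun _ _ _ φ h => continuous_of_isColimit hc φ fun j => h (op j)

theorem nonempty_isLimit_flowFunctor_of_isLimit [Finite J] {c : Cone D} (hc : IsLimit c)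
    (X : DirFlow.{u}) :
    Nonempty (IsLimit
      ((Prod.sectR (op X) DirFlow.{u} ⋙ flowFunctor hobj hmap).mapCone c)) :=
  CGWH.nonempty_isLimit_of_forget
    (IsLimit.mapConeEquiv (sectRFlowFunctorForgetIso hobj hmap X).symm
      (isLimitOfPreserves (coyoneda.obj (op X)) hc))
    fun _ _ _ φ h => continuous_of_isLimit hc φ h

end Functor

end DirFlow

universe v' w'

theorem mainTheorem3_general :
    ∃ (hobj : DirFlow.FLOWIsCGWH.{u}) (hmap : DirFlow.FLOWMapContinuous.{u}),
      (∀ (J : Type w) [Category.{v} J] (D : J ⥤ DirFlow.{u}) (c : Cocone D), IsColimit c →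
        ∀ Y : DirFlow.{u}, Nonempty (IsLimit
          ((Prod.sectL DirFlow.{u}ᵒᵖ Y ⋙ DirFlow.flowFunctor hobj hmap).mapCone c.op))) ∧
      (∀ (J : Type w') [Category.{v'} J] [Finite J] (D : J ⥤ DirFlow.{u}) (c : Cone D),
        IsLimit c → ∀ X : DirFlow.{u}, Nonempty (IsLimit
          ((Prod.sectR (op X) DirFlow.{u} ⋙ DirFlow.flowFunctor hobj hmap).mapCone c))) :=
  ⟨DirFlow.flowIsCGWH, DirFlow.flowMapContinuous,
    fun _ _ _ _ hc Y => DirFlow.nonempty_isLimit_flowFunctor_of_isColimit _ _ hc Y,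
    fun _ _ _ _ _ hc X => DirFlow.nonempty_isLimit_flowFunctor_of_isLimit _ _ hc X⟩

/-- The spaces `FLOW X Y` are weak Hausdorff `k`-spaces, composition with morphisms of flows makes
them a functor of `(X, Y)`, every functor `FLOW(-, Y)` turns colimit cocones into limit cones, and
every functor `FLOW(X, -)` preserves finite limit cones. -/
theorem mainTheorem3 :
    ∃ (hobj : DirFlow.FLOWIsCGWH.{u}) (hmap : DirFlow.FLOWMapContinuous.{u}),
      (∀ (J : Type w) [Category.{v} J] (D : J ⥤ DirFlow.{u}) (c : Cocone D), IsColimit c →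
        ∀ Y : DirFlow.{u}, Nonempty (IsLimit
          ((Prod.sectL DirFlow.{u}ᵒᵖ Y ⋙ DirFlow.flowFunctor hobj hmap).mapCone c.op))) ∧
      (∀ (J : Type w) [SmallCategory J] [FinCategory J] (D : J ⥤ DirFlow.{u}) (c : Cone D), IsLimit c →
        ∀ X : DirFlow.{u}, Nonempty (IsLimit
          ((Prod.sectR (op X) DirFlow.{u} ⋙ DirFlow.flowFunctor hobj hmap).mapCone c))) :=
  have ⟨hobj, hmap, hcolim, hlim⟩ := mainTheorem3_general.{u, v, w, w, w}
  ⟨hobj, hmap, hcolim, fun J _ _ => hlim J⟩
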